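/- Let $\Sigma=\{0,1\}$. An oracle Turing machine is a Turing machine with a work tape, which initially holds the input, and a write-only query tape; with oracle $A\subseteq\Sigma^*$ it can find out in one step whether the word on its query tape belongs to $A$ (the query tape is then erased). For $A\subseteq\Sigma^*$ let $P^A$ (resp. $NP^A$) be the class of languages over $\Sigma$ accepted with oracle $A$ by a deterministic (resp. nondeterministic) oracle Turing machine all of whose computations with oracle $A$ stop within a number of steps polynomial in the length of the input. For $B\subseteq\Sigma^*$ let $L_B=\{0^i : B\text{ contains a word of length } i\}$. Then $P^A\subseteq NP^A$ for every $A\subseteq\Sigma^*$, and there is a set $B\subseteq \Sigma^*$ such that $L_B\in NP^B$ but $L_B\notin P^B$; in particular $P^B\neq NP^B$. More precisely, such a $B$ is given by the following diagonalization. Call a deterministic oracle Turing machine polynomial if with at least one oracle its running time is bounded by a polynomial. There is a list $M_0,M_1,M_2,\dots$ of the polynomial deterministic oracle Turing machines in which each of them occurs infinitely often. Given any such list, define $f:\Sigma^*\times\mathbb N\to\{0,1\}$ by recursion on the second argument, with $F_i=\{v\in\Sigma^* : f(v,j)=0 \text{ for some } j<i\}$ and $t_i=i^{\lfloor\log_2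 i\rfloor}$: put $f(w,0)=1$ for all $w$, and, for $i\ge 1$, $f(w,i)=0$ if and only if $|w|=i$ and 1. $f(w',i)=1$ for all words $w'$ that precede $w$ lexicographically; 2. $M_i$ with oracle $F_i$ rejects $0^i$ within $t_i$ steps; 3. for every $j\le i$, $M_j$ with oracle $F_j$ on input $0^j$ does not query $w$ within $t_j$ steps. Let $\beta(w)=|w|$, let $\alpha(0)=1$, $\alpha(1)=0$, let $g(w)=\alpha(f(w,\beta(w)))$, and let $B=\{w : g(w)=1\}$. Then $g\neq f(-,m)$ for every $m\in\mathbb N$, the language $L_B$ is accepted with oracle $B$ by a nondeterministic oracle Turing machine that runs in linear time (so $L_B\in NP^B$), and $L_B\notin P^B$. -/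

import Mathlib

namespace OracleTM

/-- Binary words; `false` is the letter `0`, `true` is the letter `1`. -/
abbrev Word := List Bool

/-- Control states of an oracle machine: the distinguished states and `n` further ones. -/
inductive State (n : ℕ) : Type
  | start
  | query
  | yes
  | no
  | accept
  | reject
  | work (q : Fin n)

/-- Tape alphabet: the blank `none`, the two input letters, and `k` further symbols. -/
abbrev Sym (k : ℕ) := Option (Bool ⊕ Fin k)

/-- One instruction: new state, symbol written under the head of the work tape, movement of
that head (`none` = stay), and the letter, if any, appended to the query tape. -/
structure Instr (n k : ℕ) : Type where
  next : State n
  write : Sym k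
  move : Option Turing.Dir
  append : Option Bool

/-- Nondeterministic oracle Turing machines: one two-way infinite work tape, which initially holds
the input, and one write-only query tape. The values of `δ` at `query`, `accept` and `reject` are
never used. -/
structure NOTM : Type where
  n : ℕ
  k : ℕ
  δ : State n → Sym k → Set (Instr n k)

/-- Deterministic oracle Turing machines. -/
structure DOTM : Type where
  n : ℕ
  k : ℕ
  δ : State n → Sym k → Instr n k

/-- A deterministic machine is in particular a nondeterministic one. -/
def DOTM.toNOTM (M : DOTM) : NOTM where
  n := M.n
  k := M.k
  δ q a := {M.δ q a}

/-- Configurations: state, work tape (with head position) and word on the query tape. -/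
structure Cfg (n k : ℕ) : Type where
  state : State n
  tape : Turing.Tape (Sym k)
  queryWord : Word

/-- Moving the head, `none` meaning that it stays. -/
def moveHead {k : ℕ} : Option Turing.Dir → Turing.Tape (Sym k) → Turing.Tape (Sym k)
  | none, T => T
  | some d, T => T.move d

/-- The effect of an instruction on a configuration. -/
def Instr.apply {n k : ℕ} (a : Instr n k) (c : Cfg n k) : Cfg n k where
  state := a.next
  tape := moveHead a.move (c.tape.write a.write)
  queryWord := c.queryWord ++ a.append.toList

/-- The initial configuration on input `x`: head on the first letter, empty query tape. -/
def initCfg (n k : ℕ) (x : Word) : Cfg n k where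
  state := State.start
  tape := Turing.Tape.mk₁ (x.map fun b => some (Sum.inl b))
  queryWord := []

/-- One step of computation with oracle `B`. In the state `query` the machine learns in one step
whether the word on the query tape is in `B`, and the query tape is erased. In the states `accept`
and `reject` there is no next step. -/
inductive NOTM.Step (N : NOTM) (B : Set Word) : Cfg N.n N.k → Cfg N.n N.k → Prop
  | queryYes (c : Cfg N.n N.k) : c.state = State.query → c.queryWord ∈ B →
      NOTM.Step N B c ⟨State.yes, c.tape, []⟩
  | queryNo (c : Cfg N.n N.k) : c.state = State.query → c.queryWord ∉ B →
      NOTM.Step N B c ⟨State.no, c.tape, []⟩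
  | instr (c : Cfg N.n N.k) (a : Instr N.n N.k) : c.state ≠ State.query →
      c.state ≠ State.accept → c.state ≠ State.reject → a ∈ N.δ c.state c.tape.head →
      NOTM.Step N B c (a.apply c)

/-- `N.Reach B x m c`: some computation on input `x` with oracle `B` is in configuration `c` after
exactly `m` steps. -/
def NOTM.Reach (N : NOTM) (B : Set Word) (x : Word) : ℕ → Cfg N.n N.k → Prop
  | 0, c => c = initCfg N.n N.k x
  | m + 1, c => ∃ d, NOTM.Reach N B x m d ∧ N.Step B d c

/-- With oracle `B`, every computation on every input `x` stops after at most `T |x|` steps. -/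
def NOTM.RunsInTime (N : NOTM) (B : Set Word) (T : ℕ → ℕ) : Prop :=
  ∀ (x : Word) (m : ℕ) (c : Cfg N.n N.k), N.Reach B x m c → m ≤ T x.length

/-- The language of `N` with oracle `B`: the words on which some computation accepts. -/
def NOTM.language (N : NOTM) (B : Set Word) : Set Word :=
  {x | ∃ (m : ℕ) (c : Cfg N.n N.k), N.Reach B x m c ∧ c.state = State.accept}

/-- Languages of nondeterministic machines with oracle `B` and time bound `T`. -/
def NTIME (B : Set Word) (T : ℕ → ℕ) : Set (Set Word) :=
  {L | ∃ N : NOTM, N.RunsInTime B T ∧ N.language B = L}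

/-- Languages of deterministic machines with oracle `B` and time bound `T`. -/
def DTIME (B : Set Word) (T : ℕ → ℕ) : Set (Set Word) :=
  {L | ∃ M : DOTM, M.toNOTM.RunsInTime B T ∧ M.toNOTM.language B = L}

/-- The class `NP^B`. -/
def NP (B : Set Word) : Set (Set Word) :=
  {L | ∃ p : Polynomial ℕ, L ∈ NTIME B fun m => p.eval m}

/-- The class `P^B`. -/
def P (B : Set Word) : Set (Set Word) :=
  {L | ∃ p : Polynomial ℕ, L ∈ DTIME B fun m => p.eval m}

/-- The word `0^i`. -/
def zeros (i : ℕ) : Word := List.replicate i false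

/-- The language `L_B = {0^i : B contains a word of length i}`. -/
def tally (B : Set Word) : Set Word :=
  {x | ∃ i : ℕ, x = zeros i ∧ ∃ w ∈ B, w.length = i}

/-- With oracle `A`, the machine halts in the state `reject` on input `x` after at most `t`
steps. -/
def DOTM.RejectsWithin (M : DOTM) (A : Set Word) (x : Word) (t : ℕ) : Prop :=
  ∃ m ≤ t, ∃ c, M.toNOTM.Reach A x m c ∧ c.state = State.reject

/-- With oracle `A` and input `x`, one of the first `t` steps of the machine is a query of `w`. -/
def DOTM.QueriesWithin (M : DOTM) (A : Set Word) (x : Word) (t : ℕ) (w : Word) : Prop :=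
  ∃ m < t, ∃ c, M.toNOTM.Reach A x m c ∧ c.state = State.query ∧ c.queryWord = w

/-- Polynomial-time oracle machines: for at least one oracle the running time is bounded by a
polynomial. -/
def DOTM.IsPolyTime (M : DOTM) : Prop :=
  ∃ (A : Set Word) (p : Polynomial ℕ), M.toNOTM.RunsInTime A fun m => p.eval m

/-- `M 0, M 1, …` lists the deterministic polynomial-time oracle machines, each of them infinitely
often. -/
def IsEnumeration (M : ℕ → DOTM) : Prop :=
  (∀ i, (M i).IsPolyTime) ∧ ∀ N : DOTM, N.IsPolyTime → ∀ m, ∃ i ≥ m, M i = N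

/-- The time bound `i ^ log i`. -/
def clock (i : ℕ) : ℕ := i ^ Nat.log 2 i

/-- The word `w` has length `i`, the machine `M i` with oracle `A i` rejects `0^i` within `clock i`
steps, and no machine `M j` with `j ≤ i` queries `w` within `clock j` steps when it works on `0^j`
with oracle `A j`. -/
def Eligible (M : ℕ → DOTM) (A : ℕ → Set Word) (i : ℕ) (w : Word) : Prop :=
  w.length = i ∧ (M i).RejectsWithin (A i) (zeros i) (clock i) ∧
    ∀ j ≤ i, ¬ (M j).QueriesWithin (A j) (zeros j) (clock j) w

/-- The set of words chosen at stage `i`: none for `i = 0`, and otherwise the lexicographically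
first eligible word, if there is one. The oracle of `M j` is the set of words chosen at the stages
before `j`. -/
def chosen (M : ℕ → DOTM) (i : ℕ) : Set Word :=
  {w | 0 < i ∧
    Eligible M (fun j => {v | ∃ k, ∃ _ : k < j ∧ j ≤ i, v ∈ chosen M k}) i w ∧
    ∀ w' < w, ¬ Eligible M (fun j => {v | ∃ k, ∃ _ : k < j ∧ j ≤ i, v ∈ chosen M k}) i w'}
termination_by i
decreasing_by all_goals omega

/-- The function `f : Σ* × ℕ → 2` of the diagonalization (`true` is `1` and `false` is `0`):
`f(w, i) = 0` if and only if `w` is chosen at stage `i`. -/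
noncomputable def diagF (M : ℕ → DOTM) (w : Word) (i : ℕ) : Bool :=
  @decide (w ∉ chosen M i) (Classical.propDecidable _)

/-- The union, over all stages `j < i`, of the complements of the sets `f(-, j)`. -/
def cumul (M : ℕ → DOTM) (i : ℕ) : Set Word := {w | ∃ j < i, diagF M w j = false}

theorem diagF_eq_false_iff_mem (M : ℕ → DOTM) (w : Word) (i : ℕ) :
    diagF M w i = false ↔ w ∈ chosen M i := by
  simp [diagF]

theorem eligible_congr (M : ℕ → DOTM) {A A' : ℕ → Set Word} {i : ℕ} (h : ∀ j ≤ i, A j = A' j)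
    (w : Word) : Eligible M A i w ↔ Eligible M A' i w := by
  unfold Eligible
  rw [h i le_rfl]
  refine and_congr_right fun _ => and_congr_right fun _ => forall₂_congr fun j hj => ?_
  rw [h j hj]

theorem diagF_zero (M : ℕ → DOTM) (w : Word) : diagF M w 0 = true := by
  rw [← Bool.not_eq_false, diagF_eq_false_iff_mem, chosen]
  simp

theorem mem_chosen_iff (M : ℕ → DOTM) (w : Word) (i : ℕ) :
    w ∈ chosen M i ↔ 0 < i ∧ Eligible M (cumul M) i w ∧
      ∀ w' < w, ¬ Eligible M (cumul M) i w' := by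
  have h : ∀ j ≤ i, {v | ∃ k, ∃ _ : k < j ∧ j ≤ i, v ∈ chosen M k} = cumul M j := by
    intro j hj
    ext v
    simp only [cumul, Set.mem_ofPred_eq, diagF_eq_false_iff_mem]
    constructor
    · rintro ⟨k, ⟨hk, _⟩, hv⟩
      exact ⟨k, hk, hv⟩
    · rintro ⟨k, hk, hv⟩
      exact ⟨k, ⟨hk, hj⟩, hv⟩
  rw [chosen]
  simp only [Set.mem_ofPred_eq, eligible_congr M h]

/-- The inductive definition of `f`: for `i > 0`, `f(w, i) = 0` if and only if `w` has length `i`,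
`f(w', i) = 1` for all `w' < w`, the machine `M i` rejects `0^i` in time, and no `M j`, `j ≤ i`,
queries `w` in time on input `0^j`. -/
theorem diagF_eq_false_iff (M : ℕ → DOTM) (w : Word) (i : ℕ) (hi : 0 < i) :
    diagF M w i = false ↔ w.length = i ∧ (∀ w' < w, diagF M w' i = true) ∧
      (M i).RejectsWithin (cumul M i) (zeros i) (clock i) ∧
      ∀ j ≤ i, ¬ (M j).QueriesWithin (cumul M j) (zeros j) (clock j) w := by
  have key : ∀ v : Word, Eligible M (cumul M) i v →
      (∀ w' < v, w' ∉ chosen M i) → ∀ w' < v, ¬ Eligible M (cumul M) i w' := by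
    intro v _ hv w' hw' hE
    have hfin : {u : Word | u < v ∧ Eligible M (cumul M) i u}.Finite :=
      (List.finite_length_eq Bool i).subset fun u hu => hu.2.1
    obtain ⟨u, hu, hmin⟩ := hfin.exists_minimal ⟨w', hw', hE⟩
    refine hv u hu.1 ((mem_chosen_iff M u i).2 ⟨hi, hu.2, fun t ht hEt => ?_⟩)
    exact absurd (hmin ⟨ht.trans hu.1, hEt⟩ ht.le) (not_le_of_gt ht)
  simp only [← Bool.not_eq_false, diagF_eq_false_iff_mem]
  constructor
  · intro h
    obtain ⟨_, hE, hmin⟩ := (mem_chosen_iff M w i).1 h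
    exact ⟨hE.1, fun w' hw' hc => hmin w' hw' ((mem_chosen_iff M w' i).1 hc).2.1, hE.2.1, hE.2.2⟩
  · rintro ⟨h1, h2, h3, h4⟩
    exact (mem_chosen_iff M w i).2 ⟨hi, ⟨h1, h3, h4⟩, key w ⟨h1, h3, h4⟩ h2⟩

/-- The function `g_β = α ∘ f ∘ ⟨Id, β⟩` with `β(w) = |w|` and `α` the negation of `2`. -/
noncomputable def diagG (M : ℕ → DOTM) (w : Word) : Bool := !(diagF M w w.length)

/-- The oracle with characteristic function `g_β`. -/
def diagB (M : ℕ → DOTM) : Set Word := {w | diagG M w = true}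

end OracleTM

namespace OracleTM

/-! ### Runs of oracle machines -/

/-! The proof is a diagonalization in which a finite computation sees too little of the oracle. At
stage `i` the oracle built so far is `diagB M` cut off at lengths below `i` (`mem_cumul_iff`). If `M
i` rejects `0^i` with it in time, a word of length `i` is added, so that `M i` errs on `0^i`. The
added word is one that no `M j` with `j ≤ i` queried on `0^j`; hence later additions never disturb
an earlier run, and `M i` behaves on `0^i` with the final oracle as it did at its stage
(`reach_cumul_iff`).

The clock balances two demands. It is small enough that the machines up to `i` together query fewer
than `2 ^ i` words, so that a free word exists (`exists_eligible`); it outgrows every polynomial, so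
that a given machine, listed infinitely often, occurs at a stage where its run fits into the clock
(`exists_forall_eval_le_clock`). Membership of `tally B` in `NP B` holds for every `B`: guess a word
of the input's length and query it. -/

theorem DOTM.step_unique (M : DOTM) (B : Set Word) {c d d' : Cfg M.toNOTM.n M.toNOTM.k}
    (h : M.toNOTM.Step B c d) (h' : M.toNOTM.Step B c d') : d = d' := by
  cases h <;> cases h' <;> first | rfl | contradiction | skip
  rename_i a _ _ _ ha a' _ _ _ ha'
  have e : a = M.δ c.state c.tape.head := ha
  have e' : a' = M.δ c.state c.tape.head := ha'
  rw [e, e']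

theorem DOTM.reach_unique (M : DOTM) (B : Set Word) (x : Word) (m : ℕ) :
    ∀ {c c' : Cfg M.toNOTM.n M.toNOTM.k}, M.toNOTM.Reach B x m c → M.toNOTM.Reach B x m c' → c = c' := by
  induction m with
  | zero => intro c c' h h'; exact Eq.trans h (Eq.symm h')
  | succ m ih =>
    rintro c c' ⟨d, hd, hs⟩ ⟨d', hd', hs'⟩
    obtain rfl := ih hd hd'
    exact M.step_unique B hs hs'

theorem DOTM.exists_step (M : DOTM) (B : Set Word) (c : Cfg M.toNOTM.n M.toNOTM.k)
    (ha : c.state ≠ State.accept) (hr : c.state ≠ State.reject) : ∃ d, M.toNOTM.Step B c d := by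
  by_cases hq : c.state = State.query
  · by_cases hB : c.queryWord ∈ B
    · exact ⟨_, NOTM.Step.queryYes c hq hB⟩
    · exact ⟨_, NOTM.Step.queryNo c hq hB⟩
  · exact ⟨_, NOTM.Step.instr c (M.δ c.state c.tape.head) hq ha hr rfl⟩

theorem NOTM.not_step_of_halted (N : NOTM) (B : Set Word) {c d : Cfg N.n N.k}
    (h : c.state = State.accept ∨ c.state = State.reject) : ¬ N.Step B c d := by
  intro hs
  cases hs <;> simp_all

theorem NOTM.Reach.exists_of_le {N : NOTM} {B : Set Word} {x : Word} {m : ℕ} :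
    ∀ {m' : ℕ} {c : Cfg N.n N.k}, N.Reach B x m' c → m ≤ m' → ∃ d, N.Reach B x m d := by
  intro m' c h hm
  induction hm generalizing c with
  | refl => exact ⟨c, h⟩
  | step _ ih => obtain ⟨d, hd, _⟩ := h; exact ih hd

/-- A halted run is the whole computation of a deterministic machine. -/
theorem DOTM.halted_unique (M : DOTM) (B : Set Word) (x : Word) {m m' : ℕ}
    {c c' : Cfg M.toNOTM.n M.toNOTM.k} (h : M.toNOTM.Reach B x m c) (h' : M.toNOTM.Reach B x m' c')
    (hc : c.state = State.accept ∨ c.state = State.reject)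
    (hc' : c'.state = State.accept ∨ c'.state = State.reject) : c = c' := by
  have key : ∀ {m m' : ℕ} {c c' : Cfg M.toNOTM.n M.toNOTM.k}, M.toNOTM.Reach B x m c →
      M.toNOTM.Reach B x m' c' → (c.state = State.accept ∨ c.state = State.reject) → m' ≤ m := by
    intro m m' c c' h h' hc
    by_contra! hlt
    obtain ⟨d, e, he, hs⟩ := h'.exists_of_le (Nat.succ_le_of_lt hlt)
    obtain rfl := M.reach_unique B x m h he
    exact M.toNOTM.not_step_of_halted B hc hs
  obtain rfl : m = m' := le_antisymm (key h' h hc') (key h h' hc)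
  exact M.reach_unique B x m h h'

/-- A deterministic machine with a time bound halts in `accept` or `reject`. -/
theorem DOTM.exists_halted (M : DOTM) (B : Set Word) (T : ℕ → ℕ) (h : M.toNOTM.RunsInTime B T)
    (x : Word) : ∃ m ≤ T x.length, ∃ c, M.toNOTM.Reach B x m c ∧
      (c.state = State.accept ∨ c.state = State.reject) := by
  -- A run that never halts could be prolonged past the time bound.
  by_contra! hcon
  have key : ∀ m, ∃ c, M.toNOTM.Reach B x m c := by
    intro m
    induction m with
    | zero => exact ⟨_, rfl⟩
    | succ m ih =>
      obtain ⟨c, hc⟩ := ih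
      obtain ⟨ha, hr⟩ := hcon m (h x m c hc) c hc
      obtain ⟨d, hd⟩ := M.exists_step B c ha hr
      exact ⟨d, c, hc, hd⟩
  obtain ⟨c, hc⟩ := key (T x.length + 1)
  exact absurd (h x _ c hc) (by omega)

theorem NOTM.Step.congr_oracle {N : NOTM} {A B : Set Word} {c d : Cfg N.n N.k}
    (h : N.Step A c d) (hAB : c.state = State.query → (c.queryWord ∈ A ↔ c.queryWord ∈ B)) :
    N.Step B c d := by
  cases h with
  | queryYes hq hA => exact .queryYes c hq ((hAB hq).1 hA)
  | queryNo hq hA => exact .queryNo c hq (fun hB => hA ((hAB hq).2 hB))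
  | instr a h1 h2 h3 h4 => exact .instr c a h1 h2 h3 h4

/-- Oracles that agree on the words queried in the first `t` steps give the same runs of length at
most `t`. -/
theorem NOTM.reach_congr_oracle (N : NOTM) {A B : Set Word} (x : Word) (t : ℕ)
    (h : ∀ m < t, ∀ c, N.Reach A x m c → c.state = State.query →
      (c.queryWord ∈ A ↔ c.queryWord ∈ B)) :
    ∀ m ≤ t, ∀ c, N.Reach A x m c ↔ N.Reach B x m c := by
  intro m
  induction m with
  | zero => intro _ c; exact Iff.rfl
  | succ m ih =>
    intro hm c
    constructor
    · rintro ⟨d, hd, hs⟩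
      exact ⟨d, (ih (by omega) d).1 hd, hs.congr_oracle (h m hm d hd)⟩
    · rintro ⟨d, hd, hs⟩
      have hd' := (ih (by omega) d).2 hd
      exact ⟨d, hd', hs.congr_oracle fun hq => (h m hm d hd' hq).symm⟩

/-- At most `t` words are queried in `t` steps. -/
theorem DOTM.exists_finset_queries (M : DOTM) (A : Set Word) (x : Word) (t : ℕ) :
    ∃ S : Finset Word, S.card ≤ t ∧ ∀ w, M.QueriesWithin A x t w → w ∈ S := by
  classical
  -- By determinism there is at most one configuration, hence one query word, at each time.
  have hs : ∀ m, ∃ v : Word, ∀ c, M.toNOTM.Reach A x m c → c.queryWord = v := by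
    intro m
    by_cases h : ∃ c, M.toNOTM.Reach A x m c
    · obtain ⟨c, hc⟩ := h
      exact ⟨c.queryWord, fun d hd => by rw [M.reach_unique A x m hd hc]⟩
    · exact ⟨[], fun c hc => absurd ⟨c, hc⟩ h⟩
  choose v hv using hs
  refine ⟨(Finset.range t).image v, Finset.card_image_le.trans (by simp), ?_⟩
  rintro w ⟨m, hm, c, hc, _, rfl⟩
  exact Finset.mem_image.2 ⟨m, Finset.mem_range.2 hm, (hv m c hc).symm⟩

/-! ### Growth of the clock -/

theorem clock_mono {i j : ℕ} (hi : 0 < i) (h : j ≤ i) : clock j ≤ clock i :=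
  (Nat.pow_le_pow_left h _).trans (Nat.pow_le_pow_right hi (Nat.log_mono_right h))

theorem succ_sq_lt_two_pow {n : ℕ} (h : 6 ≤ n) : (n + 1) ^ 2 < 2 ^ n := by
  induction n, h using Nat.le_induction with
  | base => norm_num
  | succ n hn ih => rw [pow_succ 2 n]; nlinarith

/-- With `L = Nat.log 2 i`, both factors are bounded through `i + 1 ≤ 2 ^ (L + 1)`, and `(L + 1) ^ 2
< 2 ^ L ≤ i` as soon as `L ≥ 6`; this is the origin of `64`. -/
theorem succ_mul_clock_lt {i : ℕ} (hi : 64 ≤ i) : (i + 1) * clock i < 2 ^ i := by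
  have hL : 6 ≤ Nat.log 2 i := Nat.le_log_of_pow_le (by norm_num) (by simpa using hi)
  have h1 : i < 2 ^ (Nat.log 2 i + 1) := Nat.lt_pow_succ_log_self (by norm_num) i
  have h2 : 2 ^ Nat.log 2 i ≤ i := Nat.pow_log_le_self 2 (by omega)
  calc (i + 1) * clock i
      ≤ 2 ^ (Nat.log 2 i + 1) * (2 ^ (Nat.log 2 i + 1)) ^ Nat.log 2 i :=
        Nat.mul_le_mul h1 (Nat.pow_le_pow_left h1.le _)
    _ = 2 ^ (Nat.log 2 i + 1) ^ 2 := by rw [← pow_mul, ← pow_add]; congr 1; ring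
    _ < 2 ^ i := Nat.pow_lt_pow_right (by norm_num) ((succ_sq_lt_two_pow hL).trans_le h2)

theorem eval_le_eval_one_mul_pow (p : Polynomial ℕ) {i : ℕ} (hi : 0 < i) :
    p.eval i ≤ p.eval 1 * i ^ p.natDegree := by
  rw [Polynomial.eval_eq_sum_range, Polynomial.eval_eq_sum_range, Finset.sum_mul]
  refine Finset.sum_le_sum fun j hj => ?_
  rw [one_pow, mul_one]
  exact Nat.mul_le_mul_left _
    (Nat.pow_le_pow_right hi (Nat.lt_succ_iff.1 (Finset.mem_range.1 hj)))

theorem exists_forall_eval_le_clock (p : Polynomial ℕ) : ∃ i₀, ∀ i ≥ i₀, p.eval i ≤ clock i := by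
  -- The first summand lets one factor `i` absorb the sum of the coefficients, the second makes the
  -- logarithm at least `p.natDegree + 1`.
  refine ⟨p.eval 1 + 2 ^ (p.natDegree + 1), fun i hi => ?_⟩
  have hpos : 0 < 2 ^ (p.natDegree + 1) := by positivity
  calc p.eval i ≤ p.eval 1 * i ^ p.natDegree := eval_le_eval_one_mul_pow p (by omega)
    _ ≤ i * i ^ p.natDegree := Nat.mul_le_mul_right _ (by omega)
    _ = i ^ (p.natDegree + 1) := by ring
    _ ≤ clock i := Nat.pow_le_pow_right (by omega)
        (Nat.le_log_of_pow_le (by norm_num) (by omega))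

/-! ### The diagonal oracle -/

theorem mem_diagB_iff (M : ℕ → DOTM) (w : Word) : w ∈ diagB M ↔ w ∈ chosen M w.length := by
  simp [diagB, diagG, diagF_eq_false_iff_mem]

/-- A word can be chosen only at the stage equal to its length. -/
theorem mem_cumul_iff (M : ℕ → DOTM) (w : Word) (i : ℕ) :
    w ∈ cumul M i ↔ w.length < i ∧ w ∈ diagB M := by
  simp only [cumul, Set.mem_ofPred_eq, diagF_eq_false_iff_mem, mem_diagB_iff]
  constructor
  · rintro ⟨j, hj, hw⟩
    obtain rfl : w.length = j := ((mem_chosen_iff M w j).1 hw).2.1.1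
    exact ⟨hj, hw⟩
  · rintro ⟨h, hw⟩
    exact ⟨_, h, hw⟩

/-- Within the time bound, `M i` on input `0^i` cannot distinguish `diagB M` from its oracle at
stage `i`. -/
theorem reach_cumul_iff (M : ℕ → DOTM) (i : ℕ) : ∀ m ≤ clock i, ∀ c,
    (M i).toNOTM.Reach (cumul M i) (zeros i) m c ↔
      (M i).toNOTM.Reach (diagB M) (zeros i) m c := by
  refine NOTM.reach_congr_oracle _ _ _ fun m hm c hc hq => ?_
  rw [mem_cumul_iff, and_iff_right_iff_imp]
  intro hw
  -- A word of `diagB M` of length at least `i` was eligible at its own stage, so `M i` does not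
  -- query it in time.
  by_contra! hlen
  rw [mem_diagB_iff, mem_chosen_iff] at hw
  exact hw.2.1.2.2 i hlen ⟨m, hm, c, hc, hq, rfl⟩

/-- Counting: the `i + 1` machines query at most `(i + 1) * clock i` words, too few to exhaust the
`2 ^ i` words of length `i`. -/
theorem exists_eligible (M : ℕ → DOTM) (A : ℕ → Set Word) {i : ℕ} (hi : 64 ≤ i)
    (h : (M i).RejectsWithin (A i) (zeros i) (clock i)) : ∃ w, Eligible M A i w := by
  classical
  choose S hcard hS using fun j => (M j).exists_finset_queries (A j) (zeros j) (clock j)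
  have hlt : ((Finset.range (i + 1)).biUnion S).card < 2 ^ i := by
    refine lt_of_le_of_lt ?_ (succ_mul_clock_lt hi)
    refine (Finset.card_biUnion_le_card_mul _ _ (clock i) fun j hj => ?_).trans (by simp)
    exact (hcard j).trans (clock_mono (by omega) (Nat.lt_succ_iff.1 (Finset.mem_range.1 hj)))
  have hex : ∃ v : Fin i → Bool, List.ofFn v ∉ (Finset.range (i + 1)).biUnion S := by
    by_contra! hall
    have := Finset.card_le_card_of_injOn (s := Finset.univ) (List.ofFn (α := Bool) (n := i))
      (fun v _ => hall v) List.ofFn_injective.injOn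
    rw [Finset.card_univ, Fintype.card_fun, Fintype.card_bool, Fintype.card_fin] at this
    omega
  obtain ⟨v, hv⟩ := hex
  refine ⟨List.ofFn v, List.length_ofFn, h, fun j hj hq => hv ?_⟩
  exact Finset.mem_biUnion.2 ⟨j, Finset.mem_range.2 (by omega), hS j _ hq⟩

theorem exists_mem_chosen (M : ℕ → DOTM) {i : ℕ} (hi : 64 ≤ i)
    (h : (M i).RejectsWithin (cumul M i) (zeros i) (clock i)) : ∃ w, w ∈ chosen M i := by
  -- The lexicographic order on all words is not well-founded (`1 > 01 > 001 > …`), so the first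
  -- eligible word comes from the finiteness of the set of words of length `i`.
  have hfin : {u : Word | Eligible M (cumul M) i u}.Finite :=
    (List.finite_length_eq Bool i).subset fun u hu => hu.1
  obtain ⟨u, hu, hmin⟩ := hfin.exists_minimal (exists_eligible M (cumul M) hi h)
  exact ⟨u, (mem_chosen_iff M u i).2
    ⟨by omega, hu, fun t ht hEt => absurd (hmin hEt ht.le) (not_le_of_gt ht)⟩⟩

theorem zeros_mem_tally_iff (B : Set Word) (i : ℕ) :
    zeros i ∈ tally B ↔ ∃ w ∈ B, w.length = i := by
  constructor
  · rintro ⟨j, hj, h⟩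
    obtain rfl : i = j := by simpa [zeros] using congrArg List.length hj
    exact h
  · exact fun h => ⟨i, rfl, h⟩

theorem tally_diagB_notMem_P (M : ℕ → DOTM) (hM : IsEnumeration M) :
    tally (diagB M) ∉ P (diagB M) := by
  rintro ⟨p, N, hN, hL⟩
  obtain ⟨i₀, hi₀⟩ := exists_forall_eval_le_clock p
  -- Beyond `i₀` the clock exceeds the running time; beyond `64` the counting argument applies.
  obtain ⟨i, hi, rfl⟩ := hM.2 N ⟨_, p, hN⟩ (i₀ + 64)
  obtain ⟨m, hm, c, hc, hhalt⟩ := (M i).exists_halted _ _ hN (zeros i)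
  have hmt : m ≤ clock i := hm.trans (by simpa [zeros] using hi₀ i (by omega))
  rcases hhalt with hacc | hrej
  -- Acceptance forces a word of length `i` into the oracle, but one is added only if `M i` rejects.
  · have hmem : zeros i ∈ tally (diagB M) := by rw [← hL]; exact ⟨m, c, hc, hacc⟩
    obtain ⟨w, hw, hwi⟩ := (zeros_mem_tally_iff _ _).1 hmem
    rw [mem_diagB_iff, hwi, mem_chosen_iff] at hw
    obtain ⟨m', hm', c', hc', hrej'⟩ := hw.2.1.2.1
    have := (M i).halted_unique _ _ hc ((reach_cumul_iff M i m' hm' c').1 hc') (.inl hacc)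
      (.inr hrej')
    subst this
    rw [hacc] at hrej'
    cases hrej'
  -- Rejection causes a word of length `i` to be added, which puts `0^i` into the language.
  · obtain ⟨w, hw⟩ := exists_mem_chosen M (i := i) (by omega)
      ⟨m, hmt, c, (reach_cumul_iff M i m hmt c).2 hc, hrej⟩
    have hwi : w.length = i := ((mem_chosen_iff M w i).1 hw).2.1.1
    have hmem : zeros i ∈ tally (diagB M) :=
      (zeros_mem_tally_iff _ _).2 ⟨w, by rwa [mem_diagB_iff, hwi], hwi⟩
    rw [← hL] at hmem
    obtain ⟨m', c', hc', hacc⟩ := hmem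
    have := (M i).halted_unique _ _ hc hc' (.inr hrej) (.inl hacc)
    subst this
    rw [hrej] at hacc
    cases hacc

theorem diagG_ne_diagF (M : ℕ → DOTM) (m : ℕ) : diagG M ≠ fun w => diagF M w m := by
  intro h
  have := congrFun h (zeros m)
  simp [diagG, zeros] at this

/-! ### A nondeterministic machine for the tally language -/

/-- The machine that replaces the input `0^i` by a guessed query of length `i`. -/
def guessMachine : NOTM where
  n := 0
  k := 0
  δ
    | State.start, none => {⟨State.query, none, none, none⟩}
    | State.start, some (Sum.inl false) =>
        {a | ∃ b : Bool, a = ⟨State.start, some (Sum.inl false), some Turing.Dir.right, some b⟩}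
    | State.start, some (Sum.inl true) => {⟨State.reject, none, none, none⟩}
    | State.yes, s => {⟨State.accept, s, none, none⟩}
    | State.no, s => {⟨State.reject, s, none, none⟩}
    | _, _ => ∅

/-- The tape after reading the first `m` letters of the input `x`. -/
def scanTape {k : ℕ} (x : Word) (m : ℕ) : Turing.Tape (Sym k) :=
  (Turing.Tape.move Turing.Dir.right)^[m] (Turing.Tape.mk₁ (x.map fun b => some (Sum.inl b)))

theorem scanTape_head {k : ℕ} (x : Word) (m : ℕ) :
    (scanTape x m : Turing.Tape (Sym k)).head = (x[m]?).map Sum.inl := by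
  rw [scanTape, Turing.Tape.move_right_n_head, Turing.Tape.mk₁, Turing.Tape.mk₂,
    Turing.Tape.mk'_nth_nat, Turing.ListBlank.nth_mk, List.getI_eq_getElem?_getD,
    List.getElem?_map]
  cases x[m]? <;> rfl

theorem scanTape_succ {k : ℕ} (x : Word) (m : ℕ) :
    (scanTape x m : Turing.Tape (Sym k)).move Turing.Dir.right = scanTape x (m + 1) := by
  rw [scanTape, scanTape, Function.iterate_succ_apply']

/-- The invariant ties each state to the time at which it can occur, so it yields both the time
bound and soundness. For `reject` the time is only bounded, since a letter `1` in the input causes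
an early rejection. -/
theorem guessMachine_reach_inv (B : Set Word) (x : Word) (m : ℕ) :
    ∀ c : Cfg guessMachine.n guessMachine.k, guessMachine.Reach B x m c →
      (c.state = State.start ∧ c.tape = scanTape x m ∧ c.queryWord.length = m ∧ m ≤ x.length ∧
        x.take m = zeros m) ∨
      (c.state = State.query ∧ m = x.length + 1 ∧ c.queryWord.length = x.length ∧
        x = zeros x.length) ∨
      (c.state = State.yes ∧ m = x.length + 2 ∧ x ∈ tally B) ∨
      (c.state = State.no ∧ m = x.length + 2) ∨
      (c.state = State.accept ∧ m = x.length + 3 ∧ x ∈ tally B) ∨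
      (c.state = State.reject ∧ m ≤ x.length + 3) := by
  induction m with
  | zero =>
    rintro c rfl
    exact .inl ⟨rfl, rfl, rfl, Nat.zero_le _, rfl⟩
  | succ m ih =>
    rintro c ⟨d, hd, hs⟩
    rcases ih d hd with ⟨h1, h2, h3, h4, h5⟩ | ⟨h1, h2, h3, h4⟩ | ⟨h1, h2, h3⟩ | ⟨h1, h2⟩ |
      ⟨h1, -⟩ | ⟨h1, -⟩
    · cases hs with
      | queryYes hq => rw [h1] at hq; cases hq
      | queryNo hq => rw [h1] at hq; cases hq
      | instr a _ _ _ ha =>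
        have hhead := scanTape_head (k := guessMachine.k) x m
        rw [← h2] at hhead
        rw [h1, hhead] at ha
        rcases hx : x[m]? with _ | _ | _
        · rw [hx] at ha
          obtain rfl : a = ⟨State.query, none, none, none⟩ := ha
          have hm : m = x.length := le_antisymm h4 (List.getElem?_eq_none_iff.1 hx)
          refine .inr (.inl ⟨rfl, by rw [hm], ?_, ?_⟩)
          · simp [Instr.apply, h3, hm]
          · rw [hm, List.take_length] at h5; exact h5
        · rw [hx] at ha
          obtain ⟨b, rfl⟩ := ha
          obtain ⟨hm, hxm⟩ := List.getElem?_eq_some_iff.1 hx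
          refine .inl ⟨rfl, ?_, ?_, hm, ?_⟩
          -- Rewriting the scanned letter leaves the tape unchanged, so it remains a shift of the
          -- initial tape.
          · have hw : d.tape.write (some (Sum.inl false)) = d.tape := by
              have : d.tape.head = some (Sum.inl false) := by rw [hhead, hx]; rfl
              rw [← this, Turing.Tape.write_self]
            change (d.tape.write (some (Sum.inl false))).move Turing.Dir.right = _
            rw [hw, h2, scanTape_succ]
          · simp [Instr.apply, h3]
          · rw [← List.take_append_getElem hm, h5, hxm, zeros, zeros, List.replicate_succ']
        · rw [hx] at ha
          obtain rfl : a = ⟨State.reject, none, none, none⟩ := ha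
          exact .inr (.inr (.inr (.inr (.inr ⟨rfl, by omega⟩))))
    · cases hs with
      | queryYes _ hB =>
        exact .inr (.inr (.inl ⟨rfl, by omega, x.length, h4, _, hB, h3⟩))
      | queryNo _ _ => exact .inr (.inr (.inr (.inl ⟨rfl, by omega⟩)))
      | instr a h => exact absurd h1 h
    · cases hs with
      | queryYes hq => rw [h1] at hq; cases hq
      | queryNo hq => rw [h1] at hq; cases hq
      | instr a _ _ _ ha =>
        rw [h1] at ha
        obtain rfl : a = ⟨State.accept, d.tape.head, none, none⟩ := ha
        exact .inr (.inr (.inr (.inr (.inl ⟨rfl, by omega, h3⟩))))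
    · cases hs with
      | queryYes hq => rw [h1] at hq; cases hq
      | queryNo hq => rw [h1] at hq; cases hq
      | instr a _ _ _ ha =>
        rw [h1] at ha
        obtain rfl : a = ⟨State.reject, d.tape.head, none, none⟩ := ha
        exact .inr (.inr (.inr (.inr (.inr ⟨rfl, by omega⟩))))
    · exact absurd hs (NOTM.not_step_of_halted _ _ (.inl h1))
    · exact absurd hs (NOTM.not_step_of_halted _ _ (.inr h1))

/-- Completeness: one branch of the computation guesses `w` letter by letter. -/
theorem guessMachine_reach_guess (B : Set Word) (w : Word) (m : ℕ) (hm : m ≤ w.length) :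
    guessMachine.Reach B (zeros w.length) m
      ⟨State.start, scanTape (zeros w.length) m, w.take m⟩ := by
  induction m with
  | zero => rfl
  | succ m ih =>
    refine ⟨_, ih (by omega), ?_⟩
    have hhead : (scanTape (zeros w.length) m : Turing.Tape (Sym guessMachine.k)).head = some (Sum.inl false) := by
      rw [scanTape_head, zeros, List.getElem?_replicate_of_lt hm]; rfl
    have := NOTM.Step.instr (N := guessMachine) (B := B)
      ⟨State.start, scanTape (zeros w.length) m, w.take m⟩
      ⟨State.start, some (Sum.inl false), some Turing.Dir.right, some w[m]⟩
      (by simp) (by simp) (by simp) (by rw [hhead]; exact ⟨_, rfl⟩)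
    convert this using 1
    simp only [Instr.apply, moveHead, Option.toList_some, List.take_append_getElem]
    rw [← hhead, Turing.Tape.write_self, scanTape_succ]

theorem guessMachine_language (B : Set Word) : guessMachine.language B = tally B := by
  ext x
  constructor
  · rintro ⟨m, c, hc, hacc⟩
    rcases guessMachine_reach_inv B x m c hc with h | h | h | h | h | h
    case inr.inr.inr.inr.inl => exact h.2.2
    all_goals exact absurd (hacc.symm.trans h.1) (by simp)
  · rintro ⟨_, rfl, w, hw, rfl⟩
    have h0 := guessMachine_reach_guess B w w.length le_rfl
    rw [List.take_length] at h0
    have h1 := NOTM.Step.instr (N := guessMachine) (B := B)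
      ⟨State.start, scanTape (zeros w.length) w.length, w⟩
      ⟨State.query, none, none, none⟩ (by simp) (by simp) (by simp)
      (show _ ∈ guessMachine.δ State.start (scanTape (zeros w.length) w.length).head by
        rw [scanTape_head, zeros, List.getElem?_eq_none (by simp)]; rfl)
    have h2 := NOTM.Step.queryYes (N := guessMachine) (B := B)
      (Instr.apply ⟨State.query, none, none, none⟩
        ⟨State.start, scanTape (zeros w.length) w.length, w⟩) rfl (by simpa [Instr.apply] using hw)
    -- After the scan: one step into `query`, one for the answer, one to accept.
    exact ⟨w.length + 1 + 1 + 1, _, ⟨_, ⟨_, ⟨_, h0, h1⟩, h2⟩,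
      NOTM.Step.instr _ ⟨State.accept, _, none, none⟩ (by simp) (by simp) (by simp) rfl⟩, rfl⟩

theorem guessMachine_runsInTime (B : Set Word) :
    guessMachine.RunsInTime B (fun n => 3 * (n + 1)) := by
  intro x m c hc
  rcases guessMachine_reach_inv B x m c hc with h | h | h | h | h | h
  all_goals dsimp only; omega

theorem tally_mem_NTIME (B : Set Word) : tally B ∈ NTIME B (fun n => 3 * (n + 1)) :=
  ⟨guessMachine, guessMachine_runsInTime B, guessMachine_language B⟩

theorem tally_mem_NP (B : Set Word) : tally B ∈ NP B :=
  ⟨3 * (Polynomial.X + 1), by simpa using tally_mem_NTIME B⟩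

theorem P_subset_NP (A : Set Word) : P A ⊆ NP A := by
  rintro L ⟨p, M, hM, hL⟩
  exact ⟨p, M.toNOTM, hM, hL⟩

/-! ### Enumerating the machines -/

instance State.finite (n : ℕ) : Finite (State n) :=
  Finite.of_injective (β := Fin 6 ⊕ Fin n)
    (fun
      | .start => .inl 0
      | .query => .inl 1
      | .yes => .inl 2
      | .no => .inl 3
      | .accept => .inl 4
      | .reject => .inl 5
      | .work q => .inr q)
    (by intro a b h; cases a <;> cases b <;> simp_all)

instance Instr.countable (n k : ℕ) : Countable (Instr n k) :=
  Function.Injective.countable (β := State n × Sym k × Option Bool × Option Bool)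
    (f := fun a => (a.next, a.write, a.move.map fun d => decide (d = Turing.Dir.left), a.append))
    (by
      rintro ⟨s, a, d, b⟩ ⟨s', a', d', b'⟩ h
      rcases d with _ | _ | _ <;> rcases d' with _ | _ | _ <;> simp_all)

/-- For fixed `n` and `k` a transition table is a function from a finite set to a countable one. -/
instance DOTM.countable : Countable DOTM :=
  Function.Injective.countable
    (β := Σ n : ℕ, Σ k : ℕ, State n → Sym k → Instr n k) (f := fun M => ⟨M.n, M.k, M.δ⟩)
    (by
      rintro ⟨n, k, d⟩ ⟨n', k', d'⟩ h
      simp only [Sigma.mk.injEq] at h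
      obtain ⟨rfl, h⟩ := h
      simp only [heq_eq_eq, Sigma.mk.injEq] at h
      obtain ⟨rfl, h⟩ := h
      rw [eq_of_heq h])

/-- The machine that rejects at once. -/
def rejectMachine : DOTM where
  n := 0
  k := 0
  δ _ _ := ⟨State.reject, none, none, none⟩

theorem rejectMachine_isPolyTime : rejectMachine.IsPolyTime := by
  refine ⟨∅, 1, fun x m c hc => ?_⟩
  simp only [Polynomial.eval_one]
  by_contra! hm
  -- A run of two steps would contain a step out of `reject`.
  obtain ⟨d, e, ⟨f, rfl, hs⟩, hs'⟩ := NOTM.Reach.exists_of_le hc (show 1 + 1 ≤ m from hm)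
  refine NOTM.not_step_of_halted _ _ (.inr ?_) hs'
  cases hs with
  | queryYes h => cases h
  | queryNo h => cases h
  | instr a _ _ _ ha => rw [show a = _ from ha]; rfl

theorem exists_isEnumeration : ∃ M : ℕ → DOTM, IsEnumeration M := by
  have : Nonempty {N : DOTM // N.IsPolyTime} := ⟨⟨_, rejectMachine_isPolyTime⟩⟩
  obtain ⟨g, hg⟩ := exists_surjective_nat {N : DOTM // N.IsPolyTime}
  -- The second component of the pairing is idle, so each machine recurs at the indices `Nat.pair a
  -- m ≥ m`.
  refine ⟨fun i => g i.unpair.1, fun i => (g _).2, fun N hN m => ?_⟩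
  obtain ⟨a, ha⟩ := hg ⟨N, hN⟩
  refine ⟨Nat.pair a m, Nat.right_le_pair a m, ?_⟩
  simp [ha]

end OracleTM

theorem mainTheorem6 :
    (∀ A : Set OracleTM.Word, OracleTM.P A ⊆ OracleTM.NP A) ∧
    (∃ M : ℕ → OracleTM.DOTM, OracleTM.IsEnumeration M) ∧
    (∀ M : ℕ → OracleTM.DOTM, OracleTM.IsEnumeration M →
      (∀ m : ℕ, OracleTM.diagG M ≠ fun w => OracleTM.diagF M w m) ∧
      (∃ c : ℕ, OracleTM.tally (OracleTM.diagB M) ∈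
        OracleTM.NTIME (OracleTM.diagB M) (fun n => c * (n + 1))) ∧
      OracleTM.tally (OracleTM.diagB M) ∈ OracleTM.NP (OracleTM.diagB M) ∧
      OracleTM.tally (OracleTM.diagB M) ∉ OracleTM.P (OracleTM.diagB M)) ∧
    (∃ B : Set OracleTM.Word,
      OracleTM.tally B ∈ OracleTM.NP B ∧ OracleTM.tally B ∉ OracleTM.P B ∧
      OracleTM.P B ≠ OracleTM.NP B) := by
  refine ⟨OracleTM.P_subset_NP, OracleTM.exists_isEnumeration, fun M hM =>
    ⟨OracleTM.diagG_ne_diagF M, ⟨3, OracleTM.tally_mem_NTIME _⟩, OracleTM.tally_mem_NP _,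
      OracleTM.tally_diagB_notMem_P M hM⟩, ?_⟩
  obtain ⟨M, hM⟩ := OracleTM.exists_isEnumeration
  have hNP := OracleTM.tally_mem_NP (OracleTM.diagB M)
  have hP := OracleTM.tally_diagB_notMem_P M hM
  exact ⟨OracleTM.diagB M, hNP, hP, fun h => hP (h ▸ hNP)⟩
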